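/- Work in dependent type theory with $\Pi$-types, $\Sigma$-types (with their dependent eliminator), intensional identity types $a=_A b$ (with the eliminator $J$), a cumulative hierarchy of universes $\mathcal U_0:\mathcal U_1:\dots$, and function extensionality. This is a fragment of homotopy type theory; uniqueness of identity proofs is not available. "The closed type $T$ has an element" means that $\vdash t:T$ is derivable for some term $t$. Let $\mathsf{isProp}(A):\equiv\Pi(x,y:A).\,x=y$, $\mathsf{isContr}(A):\equiv\Sigma(c:A).\Pi(x:A).\,c=x$, and call $f:A\to B$ an *equivalence of types* if $\Pi(b:B).\,\mathsf{isContr}(\Sigma(a:A).\,f(a)=b)$; then $f^{-1}(b):A$ is the first component of the centre of contraction. A *wild semicategory* $C$ consists of $\mathsf{Ob}:\mathcal U_i$, $\hom:\mathsf{Ob}\to\mathsf{Ob}\to\mathcal U_j$, a composition $\circ:\Pi(x,y,z:\mathsf{Ob}).\,\hom(y,z)\to\hom(x,y)\to\hom(x,z)$, and a witness $\mathsf{assoc}$ of $(h\circ g)\circ f=h\circ(g\circ f)$ for all composable $h,g,f$; nothing is assumed about the truncation levels of $\mathsf{Ob}$ and $\hom$. For $e:\hom(x,y)$ let $\mathsf{iseqv}(e)$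 be the product of the two types stating that, for every $z:\mathsf{Ob}$, the map $(-\circ e):\hom(y,z)\to\hom(x,z)$ is an equivalence of types and that, for every $w:\mathsf{Ob}$, the map $(e\circ -):\hom(w,x)\to\hom(w,y)$ is an equivalence of types. A *good identity* on $x$ is an $i:\hom(x,x)$ with an element of $\mathsf{iseqv}(i)\times(i\circ i=i)$, and $$\mathsf{hasGoodIdStruc}(C):\equiv\Pi(x:\mathsf{Ob}).\,\Sigma(i:\hom(x,x)).\,\mathsf{iseqv}(i)\times(i\circ i=i).$$ **Theorem.** For all universe levels $i,j$, each of the following types, universally quantified over all wild semicategories $C$ (with $\mathsf{Ob}:\mathcal U_i$ and $\hom$ valued in $\mathcal U_j$), has an element. 1. $\mathsf{isProp}(\mathsf{hasGoodIdStruc}(C))$; that is, having a good identity structure is a proposition. 2. For every $x:\mathsf{Ob}$ and $i:\hom(x,x)$, functions in both directions between the type that $i$ is a good identity and the type that $i$ is two-sided neutral, i.e. $\big(\Pi(w:\mathsf{Ob})(f:\hom(w,x)).\,i\circ f=f\big)\times\big(\Pi(y:\mathsf{Ob})(g:\hom(x,y)).\,g\circ i=g\big)$. 3. For all $x,y:\mathsf{Ob}$,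 $e:\hom(x,y)$ and $p:\mathsf{iseqv}(e)$, the type that $I(e):\equiv(e\circ -)^{-1}(e):\hom(x,x)$ is a good identity on $x$. -/

import Mathlib

/-! Lean's own equality is proof-irrelevant, so that every Lean type satisfies uniqueness of
identity proofs.  The type theory in which the result lives is therefore represented by its
terms and derivations: dependent type theory with `Π`, `Σ`, intensional identity types, a
cumulative hierarchy of universes, and function extensionality.  There is no rule that would
give uniqueness of identity proofs.  All of it is part of homotopy type theory. -/

namespace TypeTheory

/-- Raw terms (and types), with de Bruijn indices.  The arguments marked `[k]` stand under `k`
binders, the innermost one being `var 0`. -/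
inductive Tm : Type where
  /-- a variable -/
  | var (n : ℕ) : Tm
  /-- the universe `U_i` -/
  | univ (i : ℕ) : Tm
  /-- `Π (x : A), B`, with `B[1]` -/
  | pi (A B : Tm) : Tm
  /-- `λ (x : A), b`, with `b[1]` -/
  | lam (A b : Tm) : Tm
  /-- `f a` -/
  | app (f a : Tm) : Tm
  /-- `Σ (x : A), B`, with `B[1]` -/
  | sig (A B : Tm) : Tm
  /-- `(a, b) : Σ (x : A), B`, with `B[1]` -/
  | pair (A B a b : Tm) : Tm
  /-- the eliminator of `Σ`: `ind (z. C) (x y. d) p`, with `C[1]` and `d[2]` -/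
  | split (C d p : Tm) : Tm
  /-- the identity type `a =_A b` -/
  | idt (A a b : Tm) : Tm
  /-- `refl_a : a =_A a` -/
  | refl (a : Tm) : Tm
  /-- the (based) eliminator `J` of the identity type: `J (y q. C) d p`, with `C[2]` -/
  | idrec (C d p : Tm) : Tm
  /-- function extensionality: an equality `f = g` from a pointwise equality `h` -/
  | funext (f g h : Tm) : Tm

namespace Tm

/-- Extension of a renaming under one binder. -/
def upr (ρ : ℕ → ℕ) : ℕ → ℕ
  | 0 => 0
  | n + 1 => ρ n + 1

/-- Renaming of variables. -/
def ren : (ℕ → ℕ) → Tm → Tm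
  | ρ, var n => var (ρ n)
  | _, univ i => univ i
  | ρ, pi A B => pi (ren ρ A) (ren (upr ρ) B)
  | ρ, lam A b => lam (ren ρ A) (ren (upr ρ) b)
  | ρ, app f a => app (ren ρ f) (ren ρ a)
  | ρ, sig A B => sig (ren ρ A) (ren (upr ρ) B)
  | ρ, pair A B a b => pair (ren ρ A) (ren (upr ρ) B) (ren ρ a) (ren ρ b)
  | ρ, split C d p => split (ren (upr ρ) C) (ren (upr (upr ρ)) d) (ren ρ p)
  | ρ, idt A a b => idt (ren ρ A) (ren ρ a) (ren ρ b)
  | ρ, refl a => refl (ren ρ a)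
  | ρ, idrec C d p => idrec (ren (upr (upr ρ)) C) (ren ρ d) (ren ρ p)
  | ρ, funext f g h => funext (ren ρ f) (ren ρ g) (ren ρ h)

/-- Weakening by `k` variables: `t.wk k` is `t` read under `k` further binders. -/
def wk (k : ℕ) (t : Tm) : Tm := ren (fun n => n + k) t

/-- Extension of a substitution under one binder. -/
def ups (σ : ℕ → Tm) : ℕ → Tm
  | 0 => var 0
  | n + 1 => wk 1 (σ n)

/-- Simultaneous (capture-avoiding) substitution. -/
def subst : (ℕ → Tm) → Tm → Tm
  | σ, var n => σ n
  | _, univ i => univ i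
  | σ, pi A B => pi (subst σ A) (subst (ups σ) B)
  | σ, lam A b => lam (subst σ A) (subst (ups σ) b)
  | σ, app f a => app (subst σ f) (subst σ a)
  | σ, sig A B => sig (subst σ A) (subst (ups σ) B)
  | σ, pair A B a b => pair (subst σ A) (subst (ups σ) B) (subst σ a) (subst σ b)
  | σ, split C d p => split (subst (ups σ) C) (subst (ups (ups σ)) d) (subst σ p)
  | σ, idt A a b => idt (subst σ A) (subst σ a) (subst σ b)
  | σ, refl a => refl (subst σ a)
  | σ, idrec C d p => idrec (subst (ups (ups σ)) C) (subst σ d) (subst σ p)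
  | σ, funext f g h => funext (subst σ f) (subst σ g) (subst σ h)

/-- The substitution `0 ↦ a`, `n + 1 ↦ σ n`. -/
def scons (a : Tm) (σ : ℕ → Tm) : ℕ → Tm
  | 0 => a
  | n + 1 => σ n

/-- `t[a/x]`, for `t` under one binder `x`. -/
def inst (t a : Tm) : Tm := subst (scons a var) t

/-- `t[a/x, b/y]`, for `t` under two binders `x`, `y` (so `x` is `var 1` and `y` is `var 0`). -/
def inst₂ (t a b : Tm) : Tm := subst (scons b (scons a var)) t

/-- For `C` under a binder `z : Σ (x : A), B`, the type `C[(x, y)/z]` under two binders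
`x : A`, `y : B`. -/
def instPair (A B C : Tm) : Tm :=
  subst (scons (pair (wk 2 A) (ren (upr (fun n => n + 2)) B) (var 1) (var 0))
    (fun n => var (n + 2))) C

end Tm

open Tm

/-- Judgmental equality: the congruence generated by the computation rules of `Π`, `Σ` and
identity types. -/
inductive Conv : Tm → Tm → Prop
  | rfl (t : Tm) : Conv t t
  | symm {s t : Tm} : Conv s t → Conv t s
  | trans {s t u : Tm} : Conv s t → Conv t u → Conv s u
  | beta (A b a : Tm) : Conv (app (lam A b) a) (inst b a)
  | split_pair (C d A B a b : Tm) : Conv (split C d (pair A B a b)) (inst₂ d a b)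
  | idrec_refl (C d a : Tm) : Conv (idrec C d (refl a)) d
  | pi {A A' B B' : Tm} : Conv A A' → Conv B B' → Conv (pi A B) (pi A' B')
  | lam {A A' b b' : Tm} : Conv A A' → Conv b b' → Conv (lam A b) (lam A' b')
  | app {f f' a a' : Tm} : Conv f f' → Conv a a' → Conv (app f a) (app f' a')
  | sig {A A' B B' : Tm} : Conv A A' → Conv B B' → Conv (sig A B) (sig A' B')
  | pair {A A' B B' a a' b b' : Tm} : Conv A A' → Conv B B' → Conv a a' → Conv b b' →
      Conv (pair A B a b) (pair A' B' a' b')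
  | split {C C' d d' p p' : Tm} : Conv C C' → Conv d d' → Conv p p' →
      Conv (split C d p) (split C' d' p')
  | idt {A A' a a' b b' : Tm} : Conv A A' → Conv a a' → Conv b b' →
      Conv (idt A a b) (idt A' a' b')
  | refl {a a' : Tm} : Conv a a' → Conv (refl a) (refl a')
  | idrec {C C' d d' p p' : Tm} : Conv C C' → Conv d d' → Conv p p' →
      Conv (idrec C d p) (idrec C' d' p')
  | funext {f f' g g' h h' : Tm} : Conv f f' → Conv g g' → Conv h h' →
      Conv (funext f g h) (funext f' g' h')

/-- `HasVar Γ n A`: the `n`-th variable of the context `Γ` is declared with type `A` (weakened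
to `Γ`).  The head of the list is the variable declared last. -/
inductive HasVar : List Tm → ℕ → Tm → Prop
  | zero (Γ : List Tm) (A : Tm) : HasVar (A :: Γ) 0 (wk 1 A)
  | succ {Γ : List Tm} {n : ℕ} {A : Tm} (B : Tm) : HasVar Γ n A →
      HasVar (B :: Γ) (n + 1) (wk 1 A)

/-- The typing judgment `Γ ⊢ t : A`, for contexts `Γ` that are well formed, such as the empty
one.  (Each rule extends a context only by a type over it.)  `A` is a type over `Γ` if
`Γ ⊢ A : U_i` for some `i`. -/
inductive HasType : List Tm → Tm → Tm → Prop
  | var {Γ : List Tm} {n : ℕ} {A : Tm} : HasVar Γ n A → HasType Γ (var n) A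
  | conv {Γ : List Tm} {t A B : Tm} {i : ℕ} :
      HasType Γ t A → HasType Γ B (univ i) → Conv A B → HasType Γ t B
  | univ (Γ : List Tm) (i : ℕ) : HasType Γ (univ i) (univ (i + 1))
  | cumul {Γ : List Tm} {A : Tm} {i : ℕ} :
      HasType Γ A (univ i) → HasType Γ A (univ (i + 1))
  | pi {Γ : List Tm} {A B : Tm} {i : ℕ} :
      HasType Γ A (univ i) → HasType (A :: Γ) B (univ i) → HasType Γ (pi A B) (univ i)
  | lam {Γ : List Tm} {A B b : Tm} {i : ℕ} :
      HasType Γ A (univ i) → HasType (A :: Γ) b B → HasType Γ (lam A b) (pi A B)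
  | app {Γ : List Tm} {A B f a : Tm} :
      HasType Γ f (pi A B) → HasType Γ a A → HasType Γ (app f a) (inst B a)
  | sig {Γ : List Tm} {A B : Tm} {i : ℕ} :
      HasType Γ A (univ i) → HasType (A :: Γ) B (univ i) → HasType Γ (sig A B) (univ i)
  | pair {Γ : List Tm} {A B a b : Tm} {i : ℕ} :
      HasType Γ A (univ i) → HasType (A :: Γ) B (univ i) →
      HasType Γ a A → HasType Γ b (inst B a) → HasType Γ (pair A B a b) (sig A B)
  | split {Γ : List Tm} {A B C d p : Tm} {i : ℕ} :
      HasType (sig A B :: Γ) C (univ i) → HasType (B :: A :: Γ) d (instPair A B C) →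
      HasType Γ p (sig A B) → HasType Γ (split C d p) (inst C p)
  | idt {Γ : List Tm} {A a b : Tm} {i : ℕ} :
      HasType Γ A (univ i) → HasType Γ a A → HasType Γ b A → HasType Γ (idt A a b) (univ i)
  | refl {Γ : List Tm} {A a : Tm} :
      HasType Γ a A → HasType Γ (refl a) (idt A a a)
  | idrec {Γ : List Tm} {A a b C d p : Tm} {i : ℕ} :
      HasType (idt (wk 1 A) (wk 1 a) (var 0) :: A :: Γ) C (univ i) →
      HasType Γ d (inst₂ C a (refl a)) → HasType Γ p (idt A a b) →
      HasType Γ (idrec C d p) (inst₂ C b p)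
  | funext {Γ : List Tm} {A B f g h : Tm} :
      HasType Γ f (pi A B) → HasType Γ g (pi A B) →
      HasType Γ h (pi A (idt B (app (wk 1 f) (var 0)) (app (wk 1 g) (var 0)))) →
      HasType Γ (funext f g h) (idt (pi A B) f g)

/-- The closed type `T` has an element. -/
def Inhabited (T : Tm) : Prop := ∃ t : Tm, HasType [] t T

/-! ### Basic notions of homotopy type theory, as terms over an arbitrary context -/

/-- `A → B` -/
def arrow (A B : Tm) : Tm := pi A (wk 1 B)

/-- `A × B` -/
def prod (A B : Tm) : Tm := sig A (wk 1 B)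

/-- First projection of an element of `Σ (x : A), B`. -/
def fst (A p : Tm) : Tm := split (wk 1 A) (var 1) p

/-- Second projection of an element of `A × B`. -/
def snd (B p : Tm) : Tm := split (wk 1 B) (var 0) p

/-- `Π (x y : A), x = y` -/
def isProp (A : Tm) : Tm := pi A (pi (wk 1 A) (idt (wk 2 A) (var 1) (var 0)))

/-- `Σ (c : A), Π (x : A), c = x` -/
def isContr (A : Tm) : Tm := sig A (pi (wk 1 A) (idt (wk 2 A) (var 1) (var 0)))

/-- `Σ (a : A), f a = b`, for `f : A → B` and `b : B` -/
def fiber (A B f b : Tm) : Tm := sig A (idt (wk 1 B) (app (wk 1 f) (var 0)) (wk 1 b))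

/-- `f : A → B` is an equivalence of types: `Π (b : B), isContr (fiber f b)`. -/
def isEquiv (A B f : Tm) : Tm := pi B (isContr (fiber (wk 1 A) (wk 1 B) (wk 1 f) (var 0)))

/-- `f⁻¹ b`, for `f : A → B` with `p : isEquiv f` -/
def inverse (A B f p b : Tm) : Tm := fst A (fst (fiber A B f b) (app p b))

/-! ### Wild semicategories -/

/-- `Ob`, `hom` and composition of a wild semicategory over some context. -/
structure Semicat : Type where
  ob : Tm
  hom : Tm
  comp : Tm

namespace Semicat

/-- Weakening by `k` variables. -/
def wk (k : ℕ) (C : Semicat) : Semicat := ⟨C.ob.wk k, C.hom.wk k, C.comp.wk k⟩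

/-- `hom(x, y)` -/
def Hom (C : Semicat) (x y : Tm) : Tm := app (app C.hom x) y

/-- `g ∘ f : hom(x, z)`, for `f : hom(x, y)` and `g : hom(y, z)` -/
def cmp (C : Semicat) (x y z g f : Tm) : Tm :=
  app (app (app (app (app C.comp x) y) z) g) f

/-- `(– ∘ e) : hom(y, z) → hom(x, z)`, for `e : hom(x, y)` -/
def precomp (C : Semicat) (x y z e : Tm) : Tm :=
  lam (C.Hom y z) ((C.wk 1).cmp (x.wk 1) (y.wk 1) (z.wk 1) (var 0) (e.wk 1))

/-- `(e ∘ –) : hom(w, x) → hom(w, y)`, for `e : hom(x, y)` -/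
def postcomp (C : Semicat) (w x y e : Tm) : Tm :=
  lam (C.Hom w x) ((C.wk 1).cmp (w.wk 1) (x.wk 1) (y.wk 1) (e.wk 1) (var 0))

/-- `Π (z : Ob), isEquiv (– ∘ e : hom(y, z) → hom(x, z))` -/
def preEquiv (C : Semicat) (x y e : Tm) : Tm :=
  pi C.ob (isEquiv ((C.wk 1).Hom (y.wk 1) (var 0)) ((C.wk 1).Hom (x.wk 1) (var 0))
    ((C.wk 1).precomp (x.wk 1) (y.wk 1) (var 0) (e.wk 1)))

/-- `Π (w : Ob), isEquiv (e ∘ – : hom(w, x) → hom(w, y))` -/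
def postEquiv (C : Semicat) (x y e : Tm) : Tm :=
  pi C.ob (isEquiv ((C.wk 1).Hom (var 0) (x.wk 1)) ((C.wk 1).Hom (var 0) (y.wk 1))
    ((C.wk 1).postcomp (var 0) (x.wk 1) (y.wk 1) (e.wk 1)))

/-- `iseqv(e)`: the morphism `e : hom(x, y)` is an equivalence. -/
def isEqv (C : Semicat) (x y e : Tm) : Tm := prod (C.preEquiv x y e) (C.postEquiv x y e)

/-- The morphism `i : hom(x, x)` is a good identity: `iseqv(i) × (i ∘ i = i)`. -/
def isGoodId (C : Semicat) (x i : Tm) : Tm :=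
  prod (C.isEqv x x i) (idt (C.Hom x x) (C.cmp x x x i i) i)

/-- `Π (x : Ob), Σ (i : hom(x, x)), iseqv(i) × (i ∘ i = i)` -/
def hasGoodIdStruc (C : Semicat) : Tm :=
  pi C.ob (sig ((C.wk 1).Hom (var 0) (var 0)) ((C.wk 2).isGoodId (var 1) (var 0)))

/-- `i : hom(x, x)` is two-sided neutral:
`(Π (w : Ob) (f : hom(w, x)), i ∘ f = f) × (Π (y : Ob) (g : hom(x, y)), g ∘ i = g)`. -/
def isNeutral (C : Semicat) (x i : Tm) : Tm :=
  prod
    (pi C.ob (pi ((C.wk 1).Hom (var 0) (x.wk 1))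
      (idt ((C.wk 2).Hom (var 1) (x.wk 2))
        ((C.wk 2).cmp (var 1) (x.wk 2) (x.wk 2) (i.wk 2) (var 0)) (var 0))))
    (pi C.ob (pi ((C.wk 1).Hom (x.wk 1) (var 0))
      (idt ((C.wk 2).Hom (x.wk 2) (var 1))
        ((C.wk 2).cmp (x.wk 2) (x.wk 2) (var 1) (var 0) (i.wk 2)) (var 0))))

/-- `I(e) = (e ∘ –)⁻¹ e : hom(x, x)`, for `e : hom(x, y)` with `p : iseqv(e)` -/
def I (C : Semicat) (x y e p : Tm) : Tm :=
  inverse (C.Hom x x) (C.Hom x y) (C.postcomp x x y e)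
    (app (snd (C.postEquiv x y e) p) x) e

/-- `Π (x : Ob) (i : hom(x, x)), (isGoodId i → isNeutral i) × (isNeutral i → isGoodId i)` -/
def goodIdIffNeutral (C : Semicat) : Tm :=
  pi C.ob (pi ((C.wk 1).Hom (var 0) (var 0))
    (prod
      (arrow ((C.wk 2).isGoodId (var 1) (var 0)) ((C.wk 2).isNeutral (var 1) (var 0)))
      (arrow ((C.wk 2).isNeutral (var 1) (var 0)) ((C.wk 2).isGoodId (var 1) (var 0)))))

/-- `Π (x y : Ob) (e : hom(x, y)) (p : iseqv(e)), isGoodId (I e)` -/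
def goodIdOfEqv (C : Semicat) : Tm :=
  pi C.ob (pi (C.wk 1).ob (pi ((C.wk 2).Hom (var 1) (var 0))
    (pi ((C.wk 3).isEqv (var 2) (var 1) (var 0))
      ((C.wk 4).isGoodId (var 3) ((C.wk 4).I (var 3) (var 2) (var 1) (var 0))))))

end Semicat

/-- `Π (x y z : Ob), hom(y, z) → hom(x, y) → hom(x, z)` -/
def compType (ob hom : Tm) : Tm :=
  let H (k : ℕ) (x y : Tm) : Tm := app (app (wk k hom) x) y
  pi ob (pi (wk 1 ob) (pi (wk 2 ob)
    (arrow (H 3 (var 1) (var 0)) (arrow (H 3 (var 2) (var 1)) (H 3 (var 2) (var 0))))))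

/-- `Π (w x y z : Ob) (h : hom(y, z)) (g : hom(x, y)) (f : hom(w, x)), (h ∘ g) ∘ f = h ∘ (g ∘ f)` -/
def assocType (C : Semicat) : Tm :=
  pi C.ob (pi (C.wk 1).ob (pi (C.wk 2).ob (pi (C.wk 3).ob
    (pi ((C.wk 4).Hom (var 1) (var 0))
      (pi ((C.wk 5).Hom (var 3) (var 2))
        (pi ((C.wk 6).Hom (var 5) (var 4))
          (idt ((C.wk 7).Hom (var 6) (var 3))
            ((C.wk 7).cmp (var 6) (var 5) (var 3)
              ((C.wk 7).cmp (var 5) (var 4) (var 3) (var 2) (var 1)) (var 0))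
            ((C.wk 7).cmp (var 6) (var 4) (var 3) (var 2)
              ((C.wk 7).cmp (var 6) (var 5) (var 4) (var 1) (var 0))))))))))

/-- `Π (Ob : U_i) (hom : Ob → Ob → U_j) (comp : …) (assoc : …), T C`, where
`C = (Ob, hom, comp)` is the generic wild semicategory over this context of four variables. -/
def forallSemicat (i j : ℕ) (T : Semicat → Tm) : Tm :=
  pi (univ i)
    (pi (arrow (var 0) (arrow (var 0) (univ j)))
      (pi (compType (var 1) (var 0))
        (pi (assocType ⟨var 2, var 1, var 0⟩)
          (T ⟨var 3, var 2, var 1⟩))))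

end TypeTheory

/-!
Let `e` be an equivalence and `e ∘ i = e`. Then `i` is left neutral, because `e ∘ (i ∘ f) = e ∘ f`
and `e ∘ –` can be cancelled, and right neutral, because every `g` is of the form `h ∘ e`. This
covers good identities as well as `I(e)`. Conversely, composition with a neutral `i` is pointwise
the identity map, so `i` is a good identity.

Let `i` and `j` be good identities on `x`. As `i` is right neutral by some `r`, both `(i, r x j)`
and `(j, q)`, where `q : j ∘ j = j`, lie in the contractible fibre of `j ∘ –` over `j`, so some path
`s : i = j` transports `r x j : j ∘ i = j` to `q`. By induction on `s`, transport of idempotency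
witnesses along `s` then takes `r x i : i ∘ i = i` to `q`, too. As being an equivalence is a
proposition, `i` with the witness `r x i` is equal to every good identity on `x`, in particular to
`i` with its own witness.

The derivations are given as terms with named variables, and their types are checked by a type
inference algorithm that is sound for the typing rules. A lemma enters the derivation of another one
as a variable, which modus ponens discharges, so that no term contains another derivation. It is
enough to treat the universe levels `(0, 0)`: renumbering the levels along a strictly monotone map
preserves derivability, which reaches `(1, 1)` and all `(i, i)`, cumulativity leads from `(1, 1)` to
`(0, 1)` and `(1, 0)`, and these are renumbered to the remaining `(i, j)`.
-/

namespace TypeTheory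

open Tm

namespace Tm

/-! ### Universe levels -/

/-- The term `t` with every universe `U_i` replaced by `U_(l i)`. -/
def relevel (l : ℕ → ℕ) : Tm → Tm
  | var n => var n
  | univ i => univ (l i)
  | pi A B => pi (relevel l A) (relevel l B)
  | lam A b => lam (relevel l A) (relevel l b)
  | app f a => app (relevel l f) (relevel l a)
  | sig A B => sig (relevel l A) (relevel l B)
  | pair A B a b => pair (relevel l A) (relevel l B) (relevel l a) (relevel l b)
  | split C d p => split (relevel l C) (relevel l d) (relevel l p)
  | idt A a b => idt (relevel l A) (relevel l a) (relevel l b)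
  | refl a => refl (relevel l a)
  | idrec C d p => idrec (relevel l C) (relevel l d) (relevel l p)
  | funext f g h => funext (relevel l f) (relevel l g) (relevel l h)

section Relevel

variable (l : ℕ → ℕ)

theorem relevel_ren (ρ : ℕ → ℕ) (t : Tm) : relevel l (ren ρ t) = ren ρ (relevel l t) := by
  induction t generalizing ρ <;> simp_all [ren, relevel]

theorem relevel_wk (k : ℕ) (t : Tm) : relevel l (wk k t) = wk k (relevel l t) :=
  relevel_ren l _ t

theorem relevel_ups (σ : ℕ → Tm) :
    (fun n => relevel l (ups σ n)) = ups (fun n => relevel l (σ n)) := by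
  funext n
  cases n <;> simp [ups, relevel, relevel_wk]

theorem relevel_subst (σ : ℕ → Tm) (t : Tm) :
    relevel l (subst σ t) = subst (fun n => relevel l (σ n)) (relevel l t) := by
  induction t generalizing σ <;> simp_all [subst, relevel, relevel_ups]

theorem relevel_scons (a : Tm) (σ : ℕ → Tm) :
    (fun n => relevel l (scons a σ n)) = scons (relevel l a) (fun n => relevel l (σ n)) := by
  funext n
  cases n <;> rfl

theorem relevel_inst (t a : Tm) : relevel l (inst t a) = inst (relevel l t) (relevel l a) := by
  simp [inst, relevel_subst, relevel_scons, relevel]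

theorem relevel_inst₂ (t a b : Tm) :
    relevel l (inst₂ t a b) = inst₂ (relevel l t) (relevel l a) (relevel l b) := by
  simp [inst₂, relevel_subst, relevel_scons, relevel]

theorem relevel_instPair (A B C : Tm) :
    relevel l (instPair A B C) = instPair (relevel l A) (relevel l B) (relevel l C) := by
  simp [instPair, relevel_subst, relevel_scons, relevel, relevel_wk, relevel_ren]

end Relevel

end Tm

theorem Conv.relevel (l : ℕ → ℕ) {s t : Tm} (h : Conv s t) :
    Conv (s.relevel l) (t.relevel l) := by
  induction h with
  | rfl t => exact .rfl _
  | symm _ ih => exact ih.symm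
  | trans _ _ ih ih' => exact ih.trans ih'
  | beta A b a => rw [relevel_inst]; exact .beta _ _ _
  | split_pair C d A B a b => rw [relevel_inst₂]; exact .split_pair _ _ _ _ _ _
  | idrec_refl C d a => exact .idrec_refl _ _ _
  | pi _ _ h₁ h₂ => exact .pi h₁ h₂
  | lam _ _ h₁ h₂ => exact .lam h₁ h₂
  | app _ _ h₁ h₂ => exact .app h₁ h₂
  | sig _ _ h₁ h₂ => exact .sig h₁ h₂
  | pair _ _ _ _ h₁ h₂ h₃ h₄ => exact .pair h₁ h₂ h₃ h₄
  | split _ _ _ h₁ h₂ h₃ => exact .split h₁ h₂ h₃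
  | idt _ _ _ h₁ h₂ h₃ => exact .idt h₁ h₂ h₃
  | refl _ h₁ => exact .refl h₁
  | idrec _ _ _ h₁ h₂ h₃ => exact .idrec h₁ h₂ h₃
  | funext _ _ _ h₁ h₂ h₃ => exact .funext h₁ h₂ h₃

theorem HasVar.relevel (l : ℕ → ℕ) {Γ : List Tm} {n : ℕ} {A : Tm} (h : HasVar Γ n A) :
    HasVar (Γ.map (Tm.relevel l)) n (A.relevel l) := by
  induction h with
  | zero Γ A => rw [relevel_wk]; exact .zero _ _
  | succ B _ ih => rw [relevel_wk]; exact .succ _ ih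

theorem HasType.cumul_le {Γ : List Tm} {A : Tm} {i k : ℕ} (h : HasType Γ A (.univ i))
    (hik : i ≤ k) : HasType Γ A (.univ k) := by
  induction hik with
  | refl => exact h
  | step _ ih => exact ih.cumul

theorem HasType.relevel {l : ℕ → ℕ} (hl : StrictMono l) {Γ : List Tm} {t A : Tm}
    (h : HasType Γ t A) : HasType (Γ.map (Tm.relevel l)) (t.relevel l) (A.relevel l) := by
  induction h with
  | var h => exact .var (h.relevel l)
  | conv _ _ hAB ih ihB => exact .conv ih ihB (hAB.relevel l)
  | univ Γ i => exact (HasType.univ _ (l i)).cumul_le (hl i.lt_succ_self)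
  | cumul _ ih => exact ih.cumul_le (hl.monotone (Nat.le_succ _))
  | pi _ _ ihA ihB => exact .pi ihA ihB
  | lam _ _ ihA ihb => exact .lam ihA ihb
  | app _ _ ihf iha => rw [relevel_inst]; exact .app ihf iha
  | sig _ _ ihA ihB => exact .sig ihA ihB
  | pair _ _ _ _ ihA ihB iha ihb => rw [relevel_inst] at ihb; exact .pair ihA ihB iha ihb
  | split _ _ _ ihC ihd ihp =>
    rw [relevel_instPair] at ihd
    rw [relevel_inst]
    exact .split ihC ihd ihp
  | idt _ _ _ ihA iha ihb => exact .idt ihA iha ihb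
  | refl _ iha => exact .refl iha
  | idrec _ _ _ ihC ihd ihp =>
    simp only [List.map_cons, Tm.relevel, relevel_wk] at ihC
    rw [relevel_inst₂] at ihd
    rw [relevel_inst₂]
    exact .idrec ihC ihd ihp
  | funext _ _ _ ihf ihg ihh =>
    simp only [Tm.relevel, relevel_wk] at ihh
    exact .funext ihf ihg ihh

theorem Inhabited.relevel {l : ℕ → ℕ} (hl : StrictMono l) {T : Tm} (h : Inhabited T) :
    Inhabited (T.relevel l) :=
  h.imp' (Tm.relevel l) fun _ ht => ht.relevel hl

/-! ### Modus ponens -/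

namespace Tm

theorem ups_comp_upr (σ : ℕ → Tm) (ρ : ℕ → ℕ) : ups σ ∘ upr ρ = ups (σ ∘ ρ) := by
  funext n
  cases n <;> rfl

theorem subst_ren (σ : ℕ → Tm) (ρ : ℕ → ℕ) (t : Tm) :
    subst σ (ren ρ t) = subst (σ ∘ ρ) t := by
  induction t generalizing σ ρ <;> simp_all [ren, subst, ups_comp_upr]

theorem ups_var : ups var = var := by
  funext n
  cases n <;> rfl

theorem subst_var (t : Tm) : subst var t = t := by
  induction t <;> simp_all [subst, ups_var]

theorem inst_wk_one (t a : Tm) : inst (wk 1 t) a = t := by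
  rw [inst, wk, subst_ren]
  exact subst_var t

end Tm

theorem Inhabited.mp {A B : Tm} (h : Inhabited (arrow A B)) (hA : Inhabited A) :
    Inhabited B := by
  obtain ⟨f, hf⟩ := h
  obtain ⟨a, ha⟩ := hA
  exact ⟨app f a, inst_wk_one B a ▸ hf.app ha⟩

/-! ### Type inference -/

namespace Tm

/-- Syntactic equality, as a Boolean function that the kernel evaluates quickly. -/
def beq : Tm → Tm → Bool
  | var m, var n => Nat.beq m n
  | univ m, univ n => Nat.beq m n
  | pi A B, pi A' B' => beq A A' && beq B B'
  | lam A b, lam A' b' => beq A A' && beq b b'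
  | app f a, app f' a' => beq f f' && beq a a'
  | sig A B, sig A' B' => beq A A' && beq B B'
  | pair A B a b, pair A' B' a' b' => beq A A' && beq B B' && beq a a' && beq b b'
  | split C d p, split C' d' p' => beq C C' && beq d d' && beq p p'
  | idt A a b, idt A' a' b' => beq A A' && beq a a' && beq b b'
  | refl a, refl a' => beq a a'
  | idrec C d p, idrec C' d' p' => beq C C' && beq d d' && beq p p'
  | funext f g h, funext f' g' h' => beq f f' && beq g g' && beq h h'
  | _, _ => false

theorem eq_of_beq {s t : Tm} (h : beq s t = true) : s = t := by
  fun_induction beq s t <;> simp_all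

/-- The result of normalizing a term, where the first argument bounds the depth of the
recursion. -/
def nf : ℕ → Tm → Tm
  | 0, t => t
  | _ + 1, var m => var m
  | _ + 1, univ m => univ m
  | n + 1, pi A B => pi (nf n A) (nf n B)
  | n + 1, lam A b => lam (nf n A) (nf n b)
  | n + 1, app f a =>
    match nf n f with
    | lam _ b => nf n (inst b a)
    | f' => app f' (nf n a)
  | n + 1, sig A B => sig (nf n A) (nf n B)
  | n + 1, pair A B a b => pair (nf n A) (nf n B) (nf n a) (nf n b)
  | n + 1, split C d p =>
    match nf n p with
    | pair _ _ a b => nf n (inst₂ d a b)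
    | p' => split (nf n C) (nf n d) p'
  | n + 1, idt A a b => idt (nf n A) (nf n a) (nf n b)
  | n + 1, refl a => refl (nf n a)
  | n + 1, idrec C d p =>
    match nf n p with
    | refl _ => nf n d
    | p' => idrec (nf n C) (nf n d) p'
  | n + 1, funext f g h => funext (nf n f) (nf n g) (nf n h)

theorem conv_nf (n : ℕ) (t : Tm) : Conv t (nf n t) := by
  induction n generalizing t with
  | zero => exact .rfl _
  | succ n ih =>
    cases t with
    | var m => exact .rfl _
    | univ m => exact .rfl _
    | pi A B => exact .pi (ih _) (ih _)
    | lam A b => exact .lam (ih _) (ih _)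
    | app f a =>
      have hf := ih f
      simp only [nf]
      split
      · next h =>
        rw [h] at hf
        exact .trans (.app hf (.rfl _)) (.trans (.beta _ _ _) (ih _))
      · exact .app hf (ih _)
    | sig A B => exact .sig (ih _) (ih _)
    | pair A B a b => exact .pair (ih _) (ih _) (ih _) (ih _)
    | split C d p =>
      have hp := ih p
      simp only [nf]
      split
      · next h =>
        rw [h] at hp
        exact .trans (.split (.rfl _) (.rfl _) hp) (.trans (.split_pair _ _ _ _ _ _) (ih _))
      · exact .split (ih _) (ih _) hp
    | idt A a b => exact .idt (ih _) (ih _) (ih _)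
    | refl a => exact .refl (ih _)
    | idrec C d p =>
      have hp := ih p
      simp only [nf]
      split
      · next h =>
        rw [h] at hp
        exact .trans (.idrec (.rfl _) (.rfl _) hp) (.trans (.idrec_refl _ _ _) (ih _))
      · exact .idrec (ih _) (ih _) hp
    | funext f g h => exact .funext (ih _) (ih _) (ih _)

end Tm

/-- The type of a variable. -/
def lookup : List Tm → ℕ → Option Tm
  | [], _ => none
  | A :: _, 0 => some (wk 1 A)
  | _ :: Γ, n + 1 => (lookup Γ n).map (wk 1)

theorem hasVar_of_lookup_eq_some {Γ : List Tm} {n : ℕ} {A : Tm} (h : lookup Γ n = some A) :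
    HasVar Γ n A := by
  induction Γ generalizing n A with
  | nil => cases h
  | cons B Γ ih =>
    cases n with
    | zero => cases h; exact .zero _ _
    | succ n =>
      obtain ⟨A, hA, rfl⟩ := Option.map_eq_some_iff.mp h
      exact .succ _ (ih hA)

section Inference

variable (n : ℕ) (inf : List Tm → Tm → Option Tm)

/-- The level of the universe that `A` belongs to, according to the type inference `inf`. -/
def universeOf (Γ : List Tm) (A : Tm) : Option ℕ := do
  match nf n (← inf Γ A) with
  | univ i => some i
  | _ => none

/-- The test that an element of `B` is also an element of `A`, by cumulativity or by conversion. -/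
def subsume (Γ : List Tm) (B A : Tm) : Option Unit :=
  match B, A with
  | univ k, univ i => guard (k ≤ i)
  | B, A =>
    bif beq B A then some () else do
      guard (beq (nf n B) (nf n A))
      let _ ← universeOf n inf Γ A
      some ()

/-- The test that `t` has type `A`, according to the type inference `inf`. -/
def check (Γ : List Tm) (t A : Tm) : Option Unit := do
  subsume n inf Γ (← inf Γ t) A

/-- A type of `t` according to the type inference `inf`, normalized if necessary for it to start
with a type former. -/
def inferHead (Γ : List Tm) (t : Tm) : Option Tm := do
  match ← inf Γ t with
  | pi A B => some (pi A B)
  | sig A B => some (sig A B)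
  | idt A a b => some (idt A a b)
  | T => do
    let _ ← universeOf n inf Γ (nf n T)
    some (nf n T)

/-- The typing rule for the head constructor of the given term, where the types of its subterms
are inferred by `inf`. -/
def inferStep (Γ : List Tm) : Tm → Option Tm
  | var m => lookup Γ m
  | univ i => some (univ (i + 1))
  | pi A B => do
    let i ← universeOf n inf Γ A
    let k ← universeOf n inf (A :: Γ) B
    some (univ (max i k))
  | lam A b => do
    let _ ← universeOf n inf Γ A
    let B ← inf (A :: Γ) b
    some (pi A B)
  | app f a => do
    let pi A B ← inferHead n inf Γ f | none
    check n inf Γ a A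
    some (inst B a)
  | sig A B => do
    let i ← universeOf n inf Γ A
    let k ← universeOf n inf (A :: Γ) B
    some (univ (max i k))
  | pair A B a b => do
    let _ ← universeOf n inf Γ A
    let _ ← universeOf n inf (A :: Γ) B
    check n inf Γ a A
    check n inf Γ b (inst B a)
    some (sig A B)
  | split C d p => do
    let sig A B ← inferHead n inf Γ p | none
    let _ ← universeOf n inf (sig A B :: Γ) C
    check n inf (B :: A :: Γ) d (instPair A B C)
    some (inst C p)
  | idt A a b => do
    let i ← universeOf n inf Γ A
    check n inf Γ a A
    check n inf Γ b A
    some (univ i)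
  | Tm.refl a => do
    let A ← inf Γ a
    some (idt A a a)
  | idrec C d p => do
    let idt A a b ← inferHead n inf Γ p | none
    let _ ← universeOf n inf (idt (wk 1 A) (wk 1 a) (var 0) :: A :: Γ) C
    check n inf Γ d (inst₂ C a (Tm.refl a))
    some (inst₂ C b p)
  | Tm.funext f g h => do
    let pi A B ← inferHead n inf Γ f | none
    check n inf Γ g (pi A B)
    check n inf Γ h (pi A (idt B (app (wk 1 f) (var 0)) (app (wk 1 g) (var 0))))
    some (idt (pi A B) f g)

end Inference

/-- A type of the given term, where the first argument bounds the depth of the recursion. -/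
def infer : ℕ → List Tm → Tm → Option Tm
  | 0, _, _ => none
  | n + 1, Γ, t => inferStep n (infer n) Γ t

/-- All types inferred by `inf` are derivable. -/
def Sound (inf : List Tm → Tm → Option Tm) : Prop :=
  ∀ Γ t A, inf Γ t = some A → HasType Γ t A

namespace Sound

variable {n : ℕ} {inf : List Tm → Tm → Option Tm} {Γ : List Tm} (hs : Sound inf)
include hs

theorem universeOf {A : Tm} {i : ℕ} (h : universeOf n inf Γ A = some i) :
    HasType Γ A (univ i) := by
  obtain ⟨U, hU, h⟩ := Option.bind_eq_some_iff.mp h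
  split at h
  · next k hk =>
    cases h
    exact .conv (hs _ _ _ hU) (.univ Γ _) (hk ▸ conv_nf n U)
  · cases h

theorem subsume {t A B : Tm} (ht : HasType Γ t B) (h : subsume n inf Γ B A = some ()) :
    HasType Γ t A := by
  unfold TypeTheory.subsume at h
  split at h
  · next k i =>
    rw [Option.guard_eq_some'] at h
    exact ht.cumul_le h
  · cases hBA : beq B A with
    | true => exact eq_of_beq hBA ▸ ht
    | false =>
      simp only [hBA, cond_false, Option.bind_eq_bind, Option.bind_eq_some_iff,
        Option.guard_eq_some'] at h
      obtain ⟨_, hnf, i, hA, -⟩ := h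
      have hconv : Conv B A := (eq_of_beq hnf ▸ conv_nf n B).trans (conv_nf n A).symm
      exact ht.conv (hs.universeOf hA) hconv

theorem check {t A : Tm} (h : check n inf Γ t A = some ()) : HasType Γ t A := by
  obtain ⟨B, hB, h⟩ := Option.bind_eq_some_iff.mp h
  exact hs.subsume (hs _ _ _ hB) h

theorem inferHead {t T : Tm} (h : inferHead n inf Γ t = some T) : HasType Γ t T := by
  obtain ⟨U, hU, h⟩ := Option.bind_eq_some_iff.mp h
  have ht := hs _ _ _ hU
  cases U
  case pi | sig | idt => cases h; exact ht
  all_goals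
    obtain ⟨i, hi, h⟩ := Option.bind_eq_some_iff.mp h
    cases h
    exact ht.conv (hs.universeOf hi) (conv_nf n _)

theorem inferStep_app {f a T : Tm} (h : inferStep n inf Γ (app f a) = some T) :
    HasType Γ (app f a) T := by
  obtain ⟨F, hf, h⟩ := Option.bind_eq_some_iff.mp h
  split at h
  · simp only [Option.bind_eq_bind, Option.bind_eq_some_iff, Option.some.injEq] at h
    obtain ⟨_, ha, rfl⟩ := h
    exact .app (hs.inferHead hf) (hs.check ha)
  · cases h

theorem inferStep_split {C d p T : Tm} (h : inferStep n inf Γ (split C d p) = some T) :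
    HasType Γ (split C d p) T := by
  obtain ⟨S, hp, h⟩ := Option.bind_eq_some_iff.mp h
  split at h
  · simp only [Option.bind_eq_bind, Option.bind_eq_some_iff, Option.some.injEq] at h
    obtain ⟨i, hC, _, hd, rfl⟩ := h
    exact .split (hs.universeOf hC) (hs.check hd) (hs.inferHead hp)
  · cases h

theorem inferStep_idrec {C d p T : Tm} (h : inferStep n inf Γ (idrec C d p) = some T) :
    HasType Γ (idrec C d p) T := by
  obtain ⟨E, hp, h⟩ := Option.bind_eq_some_iff.mp h
  split at h
  · simp only [Option.bind_eq_bind, Option.bind_eq_some_iff, Option.some.injEq] at h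
    obtain ⟨i, hC, _, hd, rfl⟩ := h
    exact .idrec (hs.universeOf hC) (hs.check hd) (hs.inferHead hp)
  · cases h

theorem inferStep_funext {f g e T : Tm} (h : inferStep n inf Γ (Tm.funext f g e) = some T) :
    HasType Γ (Tm.funext f g e) T := by
  obtain ⟨F, hf, h⟩ := Option.bind_eq_some_iff.mp h
  split at h
  · simp only [Option.bind_eq_bind, Option.bind_eq_some_iff, Option.some.injEq] at h
    obtain ⟨_, hg, _, he, rfl⟩ := h
    exact .funext (hs.inferHead hf) (hs.check hg) (hs.check he)
  · cases h

theorem inferStep : Sound (inferStep n inf) := by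
  intro Γ t T h
  cases t
  case app => exact hs.inferStep_app h
  case split => exact hs.inferStep_split h
  case idrec => exact hs.inferStep_idrec h
  case funext => exact hs.inferStep_funext h
  all_goals
    simp only [TypeTheory.inferStep, Option.bind_eq_bind, Option.bind_eq_some_iff,
      Option.some.injEq] at h
  case var m => exact .var (hasVar_of_lookup_eq_some h)
  case univ i => exact h ▸ .univ Γ i
  case pi A B =>
    obtain ⟨i, hA, k, hB, rfl⟩ := h
    exact .pi ((hs.universeOf hA).cumul_le (le_max_left i k))
      ((hs.universeOf hB).cumul_le (le_max_right i k))
  case lam A b =>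
    obtain ⟨i, hA, B, hb, rfl⟩ := h
    exact .lam (hs.universeOf hA) (hs _ _ _ hb)
  case sig A B =>
    obtain ⟨i, hA, k, hB, rfl⟩ := h
    exact .sig ((hs.universeOf hA).cumul_le (le_max_left i k))
      ((hs.universeOf hB).cumul_le (le_max_right i k))
  case pair A B a b =>
    obtain ⟨i, hA, k, hB, _, ha, _, hb, rfl⟩ := h
    exact .pair ((hs.universeOf hA).cumul_le (le_max_left i k))
      ((hs.universeOf hB).cumul_le (le_max_right i k)) (hs.check ha) (hs.check hb)
  case idt A a b =>
    obtain ⟨i, hA, _, ha, _, hb, rfl⟩ := h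
    exact .idt (hs.universeOf hA) (hs.check ha) (hs.check hb)
  case refl a =>
    obtain ⟨A, ha, rfl⟩ := h
    exact .refl (hs _ _ _ ha)

end Sound

theorem sound_infer (n : ℕ) : Sound (infer n) := by
  induction n with
  | zero => intro _ _ _ h; cases h
  | succ n hs => exact hs.inferStep

/-! ### Terms with named variables -/

/-- A term of the type theory whose binders are functions on terms; it can be read in a
context of any length. -/
structure Expr : Type where
  /-- the term in a context of length `n` -/
  under (n : ℕ) : Tm

namespace Expr

/-- Application `f a`. -/
instance : CoeFun Expr fun _ => Expr → Expr :=
  ⟨fun f a => ⟨fun n => .app (f.under n) (a.under n)⟩⟩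

/-- The `k`-th variable of the context, counted from the outermost one: the number of a variable
then does not change when the context is extended. -/
def ref (k : ℕ) : Expr := ⟨fun n => .var (n - (k + 1))⟩

/-- `U_k` -/
def univ (k : ℕ) : Expr := ⟨fun _ => .univ k⟩

/-- `Π (x : A), B x` -/
def pi (A : Expr) (B : Expr → Expr) : Expr :=
  ⟨fun n => .pi (A.under n) ((B (ref n)).under (n + 1))⟩

/-- `λ (x : A), b x` -/
def lam (A : Expr) (b : Expr → Expr) : Expr :=
  ⟨fun n => .lam (A.under n) ((b (ref n)).under (n + 1))⟩

/-- `A → B` -/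
def arrow (A B : Expr) : Expr := ⟨fun n => TypeTheory.arrow (A.under n) (B.under n)⟩

/-- `Σ (x : A), B x` -/
def sig (A : Expr) (B : Expr → Expr) : Expr :=
  ⟨fun n => .sig (A.under n) ((B (ref n)).under (n + 1))⟩

/-- `(a, b) : Σ (x : A), B x` -/
def pair (A : Expr) (B : Expr → Expr) (a b : Expr) : Expr :=
  ⟨fun n => .pair (A.under n) ((B (ref n)).under (n + 1)) (a.under n) (b.under n)⟩

/-- The element of `C p` defined by `d x y : C (x, y)`. -/
def split (C : Expr → Expr) (p : Expr) (d : Expr → Expr → Expr) : Expr :=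
  ⟨fun n =>
    .split ((C (ref n)).under (n + 1)) ((d (ref n) (ref (n + 1))).under (n + 2)) (p.under n)⟩

/-- First projection out of `Σ (x : A), B x`. -/
def fst (A p : Expr) : Expr := split (fun _ => A) p fun a _ => a

/-- Second projection out of `Σ (x : A), B x`. -/
def snd (A : Expr) (B : Expr → Expr) (p : Expr) : Expr :=
  split (fun p => B (fst A p)) p fun _ b => b

/-- `A × B` -/
def prod (A B : Expr) : Expr := ⟨fun n => TypeTheory.prod (A.under n) (B.under n)⟩

/-- `a =_A b` -/
def id (A a b : Expr) : Expr := ⟨fun n => .idt (A.under n) (a.under n) (b.under n)⟩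

/-- `refl_a` -/
def refl (a : Expr) : Expr := ⟨fun n => .refl (a.under n)⟩

/-- The element of `C b p`, for `p : a = b`, defined by `d : C a refl_a`. -/
def J (C : Expr → Expr → Expr) (p d : Expr) : Expr :=
  ⟨fun n => .idrec ((C (ref n) (ref (n + 1))).under (n + 2)) (d.under n) (p.under n)⟩

/-- `f = g` from `h x : f x = g x` for `x : A` -/
def funext (f g A : Expr) (h : Expr → Expr) : Expr :=
  ⟨fun n => .funext (f.under n) (g.under n) ((lam A h).under n)⟩

/-- `p⁻¹ : b = a`, for `p : a = b` in `A` -/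
def inv (A a p : Expr) : Expr := J (fun y _ => id A y a) p (refl a)

/-- `p ⬝ q : a = c`, for `p : a = b` and `q : b = c` in `A` -/
def trans (A a p q : Expr) : Expr := J (fun y _ => id A a y) q p

/-- `f a = f b` in `B`, for `p : a = b` -/
def ap (B : Expr) (f : Expr → Expr) (a p : Expr) : Expr :=
  J (fun y _ => id B (f a) (f y)) p (refl (f a))

/-- The element of `P b` given by `d : P a` and `p : a = b`. -/
def transport (P : Expr → Expr) (p d : Expr) : Expr := J (fun y _ => P y) p d

/-- `Π (x y : A), x = y` -/
def isProp (A : Expr) : Expr := ⟨fun n => TypeTheory.isProp (A.under n)⟩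

/-- `Π (x : A), c = x` -/
def contraction (A c : Expr) : Expr := pi A fun x => id A c x

/-- `Σ (c : A), Π (x : A), c = x` -/
def isContr (A : Expr) : Expr := ⟨fun n => TypeTheory.isContr (A.under n)⟩

/-- `Σ (a : A), f a = b` -/
def fiber (A B f b : Expr) : Expr :=
  ⟨fun n => TypeTheory.fiber (A.under n) (B.under n) (f.under n) (b.under n)⟩

/-- `f : A → B` is an equivalence of types. -/
def isEquiv (A B f : Expr) : Expr :=
  ⟨fun n => TypeTheory.isEquiv (A.under n) (B.under n) (f.under n)⟩

/-- The closed type `T` has an element. -/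
def Holds (T : Expr) : Prop := Inhabited (T.under 0)

/-- Whether type inference, up to a depth that suffices for the terms below, shows the closed term
`t` to have type `T`. -/
def accepts (t T : Expr) : Bool := (check 100 (infer 100) [] (t.under 0) (T.under 0)).isSome

theorem holds_of_accepts {T : Expr} (t : Expr) (h : accepts t T = true) : Holds T :=
  ⟨_, (sound_infer 100).check (Option.eq_some_of_isSome h)⟩

theorem Holds.mp {L T : Expr} (h : Holds (arrow L T)) (hL : Holds L) : Holds T :=
  Inhabited.mp h hL

/-- A proof of `T` by the term `t` from a lemma `L`, which stays a variable of `t`. -/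
theorem Holds.imp₁ {L T : Expr} (hL : Holds L) (t : Expr → Expr)
    (h : accepts (lam L t) (arrow L T) = true) : Holds T :=
  (holds_of_accepts _ h).mp hL

theorem Holds.imp₂ {L M T : Expr} (hL : Holds L) (hM : Holds M) (t : Expr → Expr → Expr)
    (h : accepts (lam L fun l => lam M (t l)) (arrow L (arrow M T)) = true) : Holds T :=
  ((holds_of_accepts _ h).mp hL).mp hM

theorem Holds.imp₃ {L M N T : Expr} (hL : Holds L) (hM : Holds M) (hN : Holds N)
    (t : Expr → Expr → Expr → Expr)
    (h : accepts (lam L fun l => lam M fun m => lam N (t l m)) (arrow L (arrow M (arrow N T)))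
      = true) : Holds T :=
  (((holds_of_accepts _ h).mp hL).mp hM).mp hN

/-! ### Propositions and equivalences -/

theorem isProp_of_isContr : Holds (pi (univ 0) fun A => arrow (isContr A) (isProp A)) :=
  holds_of_accepts
    (lam (univ 0) fun A => lam (isContr A) fun w =>
      split (fun _ => isProp A) w fun c h =>
        lam A fun x => lam A fun y => trans A x (inv A c (h x)) (h y))
    (by decide +kernel)

theorem isProp_pi :
    Holds (pi (univ 0) fun A => pi (arrow A (univ 0)) fun B =>
      arrow (pi A fun x => isProp (B x)) (isProp (pi A fun x => B x))) :=
  holds_of_accepts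
    (lam (univ 0) fun A => lam (arrow A (univ 0)) fun B =>
      lam (pi A fun x => isProp (B x)) fun h =>
        let P := pi A fun x => B x
        lam P fun f => lam P fun g => funext f g A fun x => h x (f x) (g x))
    (by decide +kernel)

theorem isProp_prod :
    Holds (pi (univ 0) fun A => pi (univ 0) fun B =>
      arrow (isProp A) (arrow (isProp B) (isProp (prod A B)))) :=
  holds_of_accepts
    (lam (univ 0) fun A => lam (univ 0) fun B =>
      lam (isProp A) fun hA => lam (isProp B) fun hB =>
        let P := prod A B
        let mk := pair A fun _ => B
        lam P fun u => lam P fun v =>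
          split (fun u => id P u v) u fun a b => split (fun v => id P (mk a b) v) v fun a' b' =>
            trans P (mk a b) (ap P (fun a => mk a b) a (hA a a')) (ap P (mk a') b (hB b b')))
    (by decide +kernel)

theorem inv_trans_self :
    Holds (pi (univ 0) fun A => pi A fun x => pi A fun y => pi (id A x y) fun p =>
      id (id A y y) (trans A y (inv A x p) p) (refl y)) :=
  holds_of_accepts
    (lam (univ 0) fun A => lam A fun x => lam A fun y => lam (id A x y) fun p =>
      J (fun y p => id (id A y y) (trans A y (inv A x p) p) (refl y)) p (refl (refl x)))
    (by decide +kernel)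

/-- Every path `q : x = y` equals `(h x x)⁻¹ ⬝ h x y`, which does not depend on `q`. -/
theorem isProp_id :
    Holds (pi (univ 0) fun A => arrow (isProp A) (pi A fun x => pi A fun y =>
      isProp (id A x y))) :=
  inv_trans_self.imp₁
    (fun inv_trans_self =>
      lam (univ 0) fun A => lam (isProp A) fun h => lam A fun x => lam A fun y =>
        let canonical := fun y => trans A x (inv A x (h x x)) (h x y)
        let eq_canonical := fun q =>
          J (fun y q => id (id A x y) (canonical y) q) q (inv_trans_self A x x (h x x))
        lam (id A x y) fun p => lam (id A x y) fun q =>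
          trans (id A x y) p (inv (id A x y) (canonical y) (eq_canonical p)) (eq_canonical q))
    (by decide +kernel)

theorem isProp_contraction :
    Holds (pi (univ 0) fun A => arrow (isProp A) (pi A fun c => isProp (contraction A c))) :=
  isProp_pi.imp₂ isProp_id
    (fun isProp_pi isProp_id =>
      lam (univ 0) fun A => lam (isProp A) fun h => lam A fun c =>
        isProp_pi A (lam A fun x => id A c x) (lam A fun x => isProp_id A h c x))
    (by decide +kernel)

theorem pair_eq :
    Holds (pi (univ 0) fun A => pi (arrow A (univ 0)) fun B =>
      pi A fun a => pi (B a) fun b => pi A fun a' => pi (B a') fun b' =>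
        pi (id A a a') fun s => arrow (id (B a') (transport (B ·) s b) b')
          (id (sig A (B ·)) (pair A (B ·) a b) (pair A (B ·) a' b'))) :=
  holds_of_accepts
    (lam (univ 0) fun A => lam (arrow A (univ 0)) fun B =>
      lam A fun a => lam (B a) fun b => lam A fun a' => lam (B a') fun b' =>
        let S := sig A (B ·)
        let mk := pair A (B ·)
        lam (id A a a') fun s =>
          J (fun a' s => pi (B a') fun b' =>
              arrow (id (B a') (transport (B ·) s b) b') (id S (mk a b) (mk a' b'))) s
            (lam (B a) fun b' => lam (id (B a) b b') fun t => ap S (mk a) b t) b')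
    (by decide +kernel)

theorem isProp_isContr : Holds (pi (univ 0) fun A => isProp (isContr A)) :=
  isProp_of_isContr.imp₃ isProp_contraction pair_eq
    (fun isProp_of_isContr isProp_contraction pair_eq =>
      lam (univ 0) fun A =>
        let K := isContr A
        let mk := pair A (contraction A)
        lam K fun u => lam K fun v =>
          split (fun u => id K u v) u fun c h => split (fun v => id K (mk c h) v) v fun c' h' =>
            pair_eq A (lam A (contraction A)) c h c' h' (h c')
              (isProp_contraction A (isProp_of_isContr A (mk c h)) c'
                (transport (contraction A) (h c') h) h'))
    (by decide +kernel)

theorem isProp_isEquiv :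
    Holds (pi (univ 0) fun A => pi (univ 0) fun B => pi (arrow A B) fun f =>
      isProp (isEquiv A B f)) :=
  isProp_pi.imp₂ isProp_isContr
    (fun isProp_pi isProp_isContr =>
      lam (univ 0) fun A => lam (univ 0) fun B => lam (arrow A B) fun f =>
        isProp_pi B (lam B fun b => isContr (fiber A B f b))
          (lam B fun b => isProp_isContr (fiber A B f b)))
    (by decide +kernel)

theorem eq_of_isEquiv :
    Holds (pi (univ 0) fun A => pi (univ 0) fun B => pi (arrow A B) fun f =>
      arrow (isEquiv A B f) (pi A fun a => pi A fun a' =>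
        arrow (id B (f a) (f a')) (id A a a'))) :=
  isProp_of_isContr.imp₁
    (fun isProp_of_isContr =>
      lam (univ 0) fun A => lam (univ 0) fun B => lam (arrow A B) fun f =>
        lam (isEquiv A B f) fun w => lam A fun a => lam A fun a' =>
          let F := fiber A B f (f a')
          let mk := pair A fun x => id B (f x) (f a')
          lam (id B (f a) (f a')) fun p =>
            ap A (fst A) (mk a p)
              (isProp_of_isContr F (w (f a')) (mk a p) (mk a' (refl (f a')))))
    (by decide +kernel)

theorem isEquiv_id : Holds (pi (univ 0) fun A => isEquiv A A (lam A fun x => x)) :=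
  holds_of_accepts
    (lam (univ 0) fun A =>
      let F := fiber A A (lam A fun x => x)
      let mk := fun b => pair A fun x => id A x b
      lam A fun b => pair (F b) (contraction (F b)) (mk b b (refl b)) (lam (F b) fun w =>
        split (fun w => id (F b) (mk b b (refl b)) w) w fun a p =>
          J (fun y q => id (F y) (mk y y (refl y)) (mk y a q)) p (refl (mk a a (refl a)))))
    (by decide +kernel)

theorem isEquiv_of_forall_eq :
    Holds (pi (univ 0) fun A => pi (arrow A A) fun f =>
      arrow (pi A fun x => id A (f x) x) (isEquiv A A f)) :=
  isEquiv_id.imp₁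
    (fun isEquiv_id =>
      lam (univ 0) fun A => lam (arrow A A) fun f => lam (pi A fun x => id A (f x) x) fun h =>
        transport (isEquiv A A) (funext (lam A fun x => x) f A fun x => inv A (f x) (h x))
          (isEquiv_id A))
    (by decide +kernel)

theorem exists_transport_eq_of_pair_eq :
    Holds (pi (univ 0) fun A => pi (arrow A (univ 0)) fun B =>
      pi A fun a => pi (B a) fun b => pi A fun a' => pi (B a') fun b' =>
        arrow (id (sig A (B ·)) (pair A (B ·) a b) (pair A (B ·) a' b'))
          (sig (id A a a') fun s => id (B a') (transport (B ·) s b) b')) :=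
  holds_of_accepts
    (lam (univ 0) fun A => lam (arrow A (univ 0)) fun B =>
      lam A fun a => lam (B a) fun b => lam A fun a' => lam (B a') fun b' =>
        lam (id (sig A (B ·)) (pair A (B ·) a b) (pair A (B ·) a' b')) fun r =>
          J (fun v _ => sig (id A a (fst A v)) fun s =>
              id (B (fst A v)) (transport (B ·) s b) (snd A (B ·) v)) r
            (pair (id A a a) (fun s => id (B a) (transport (B ·) s b) b) (refl a) (refl b)))
    (by decide +kernel)

theorem triple_eq :
    Holds (pi (univ 0) fun A => pi (arrow A (univ 0)) fun B => pi (arrow A (univ 0)) fun C =>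
      arrow (pi A fun a => isProp (B a)) (
        let S := fun a => prod (B a) (C a)
        let mk := fun a b c => pair A S a (pair (B a) (fun _ => C a) b c)
        pi A fun a => pi (B a) fun b => pi (C a) fun c =>
          pi A fun a' => pi (B a') fun b' => pi (C a') fun c' =>
            pi (id A a a') fun s => arrow (id (C a') (transport (C ·) s c) c')
              (id (sig A S) (mk a b c) (mk a' b' c')))) :=
  holds_of_accepts
    (lam (univ 0) fun A => lam (arrow A (univ 0)) fun B => lam (arrow A (univ 0)) fun C =>
      lam (pi A fun a => isProp (B a)) fun h =>
        let S := fun a => prod (B a) (C a)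
        let mk := fun a b c => pair A S a (pair (B a) (fun _ => C a) b c)
        lam A fun a => lam (B a) fun b => lam (C a) fun c =>
          lam A fun a' => lam (B a') fun b' => lam (C a') fun c' => lam (id A a a') fun s =>
            J (fun a' s => pi (B a') fun b' => pi (C a') fun c' =>
                arrow (id (C a') (transport (C ·) s c) c')
                  (id (sig A S) (mk a b c) (mk a' b' c'))) s
              (lam (B a) fun b' => lam (C a) fun c' => lam (id (C a) c c') fun t =>
                trans (sig A S) (mk a b c)
                  (ap (sig A S) (fun b => mk a b c) b (h a b b')) (ap (sig A S) (mk a b') c t))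
              b' c')
    (by decide +kernel)

/-! ### Wild semicategories -/

/-- A wild semicategory given by four terms, in a context of any length. -/
structure Cat : Type where
  /-- the type of objects -/
  ob : Expr
  /-- the family of types of morphisms -/
  hom : Expr
  /-- the composition -/
  comp : Expr
  /-- the associativity of the composition -/
  assoc : Expr

namespace Cat

/-- The wild semicategory given by the variables `k`, …, `k + 3`, counted from the outermost one. -/
def ref (k : ℕ) : Cat := ⟨.ref k, .ref (k + 1), .ref (k + 2), .ref (k + 3)⟩

/-- The objects, morphisms and composition in a context of length `n`. -/
def under (C : Cat) (n : ℕ) : Semicat := ⟨C.ob.under n, C.hom.under n, C.comp.under n⟩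

/-- `Π C, B C`, for wild semicategories `C` with `Ob : U_a` and `hom` valued in `U_b` -/
def pi (a b : ℕ) (B : Cat → Expr) : Expr :=
  ⟨fun n => forallSemicat a b fun _ => (B (ref n)).under (n + 4)⟩

/-- `λ C, t C`, for wild semicategories `C` with `Ob : U_a` and `hom` valued in `U_b` -/
def lam (a b : ℕ) (t : Cat → Expr) : Expr :=
  ⟨fun n =>
    .lam (.univ a) (.lam (TypeTheory.arrow (.var 0) (TypeTheory.arrow (.var 0) (.univ b)))
      (.lam (compType (.var 1) (.var 0)) (.lam (assocType ⟨.var 2, .var 1, .var 0⟩)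
        ((t (ref n)).under (n + 4)))))⟩

variable (C : Cat)

/-- The instance `l C` of a fact `l : Π C, B C`. -/
def spec (l : Expr) : Expr := l C.ob C.hom C.comp C.assoc

/-- `hom(x, y)` -/
def Hom (x y : Expr) : Expr := C.hom x y

/-- `g ∘ f : hom(x, z)`, for `f : hom(x, y)` and `g : hom(y, z)` -/
def cmp (x y z g f : Expr) : Expr := C.comp x y z g f

/-- `(– ∘ e) : hom(y, z) → hom(x, z)`, for `e : hom(x, y)` -/
def precomp (x y z e : Expr) : Expr := .lam (C.Hom y z) fun g => C.cmp x y z g e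

/-- `(e ∘ –) : hom(w, x) → hom(w, y)`, for `e : hom(x, y)` -/
def postcomp (w x y e : Expr) : Expr := .lam (C.Hom w x) fun f => C.cmp w x y e f

/-- `Π (z : Ob), isEquiv (– ∘ e : hom(y, z) → hom(x, z))` -/
def preEquiv (x y e : Expr) : Expr :=
  .pi C.ob fun z => isEquiv (C.Hom y z) (C.Hom x z) (C.precomp x y z e)

/-- `Π (w : Ob), isEquiv (e ∘ – : hom(w, x) → hom(w, y))` -/
def postEquiv (x y e : Expr) : Expr :=
  .pi C.ob fun w => isEquiv (C.Hom w x) (C.Hom w y) (C.postcomp w x y e)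

/-- `iseqv(e)`, for `e : hom(x, y)` -/
def isEqv (x y e : Expr) : Expr := prod (C.preEquiv x y e) (C.postEquiv x y e)

/-- `i ∘ i = i` -/
def isIdem (x i : Expr) : Expr := id (C.Hom x x) (C.cmp x x x i i) i

/-- `i : hom(x, x)` is a good identity. -/
def isGoodId (x i : Expr) : Expr := prod (C.isEqv x x i) (C.isIdem x i)

/-- `Σ (i : hom(x, x)), iseqv(i) × (i ∘ i = i)` -/
def GoodId (x : Expr) : Expr := sig (C.Hom x x) (C.isGoodId x)

/-- The element of `GoodId x` consisting of `i`, `p : iseqv(i)` and `q : i ∘ i = i`. -/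
def mkGoodId (x i p q : Expr) : Expr :=
  pair (C.Hom x x) (C.isGoodId x) i (pair (C.isEqv x x i) (fun _ => C.isIdem x i) p q)

/-- `Π (w : Ob) (f : hom(w, x)), i ∘ f = f` -/
def isLeftNeutral (x i : Expr) : Expr :=
  .pi C.ob fun w => .pi (C.Hom w x) fun f => id (C.Hom w x) (C.cmp w x x i f) f

/-- `Π (y : Ob) (g : hom(x, y)), g ∘ i = g` -/
def isRightNeutral (x i : Expr) : Expr :=
  .pi C.ob fun y => .pi (C.Hom x y) fun g => id (C.Hom x y) (C.cmp x x y g i) g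

/-- `i : hom(x, x)` is two-sided neutral. -/
def isNeutral (x i : Expr) : Expr := prod (C.isLeftNeutral x i) (C.isRightNeutral x i)

/-- `Π (x : Ob), Σ (i : hom(x, x)), iseqv(i) × (i ∘ i = i)` -/
def hasGoodIdStruc : Expr := ⟨fun n => (C.under n).hasGoodIdStruc⟩

/-- `Π (x : Ob) (i : hom(x, x)), (isGoodId i → isNeutral i) × (isNeutral i → isGoodId i)` -/
def goodIdIffNeutral : Expr := ⟨fun n => (C.under n).goodIdIffNeutral⟩

/-- `Π (x y : Ob) (e : hom(x, y)) (p : iseqv(e)), isGoodId (I e)` -/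
def goodIdOfEqv : Expr := ⟨fun n => (C.under n).goodIdOfEqv⟩

end Cat

theorem isProp_isEqv :
    Holds (Cat.pi 0 0 fun C => pi C.ob fun x => pi C.ob fun y => pi (C.Hom x y) fun e =>
      isProp (C.isEqv x y e)) :=
  isProp_prod.imp₃ isProp_pi isProp_isEquiv
    (fun isProp_prod isProp_pi isProp_isEquiv =>
      Cat.lam 0 0 fun C => lam C.ob fun x => lam C.ob fun y => lam (C.Hom x y) fun e =>
        let Pre := fun z => isEquiv (C.Hom y z) (C.Hom x z) (C.precomp x y z e)
        let Post := fun w => isEquiv (C.Hom w x) (C.Hom w y) (C.postcomp w x y e)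
        isProp_prod (pi C.ob Pre) (pi C.ob Post)
          (isProp_pi C.ob (lam C.ob Pre)
            (lam C.ob fun z => isProp_isEquiv (C.Hom y z) (C.Hom x z) (C.precomp x y z e)))
          (isProp_pi C.ob (lam C.ob Post)
            (lam C.ob fun w => isProp_isEquiv (C.Hom w x) (C.Hom w y) (C.postcomp w x y e))))
    (by decide +kernel)

/-- `e ∘ –` is injective and `e ∘ (i ∘ f) = (e ∘ i) ∘ f = e ∘ f`. -/
theorem isLeftNeutral_of_comp_eq :
    Holds (Cat.pi 0 0 fun C => pi C.ob fun x => pi C.ob fun y => pi (C.Hom x y) fun e =>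
      arrow (C.isEqv x y e) (pi (C.Hom x x) fun i =>
        arrow (id (C.Hom x y) (C.cmp x x y e i) e) (C.isLeftNeutral x i))) :=
  eq_of_isEquiv.imp₁
    (fun eq_of_isEquiv =>
      Cat.lam 0 0 fun C => lam C.ob fun x => lam C.ob fun y => lam (C.Hom x y) fun e =>
        lam (C.isEqv x y e) fun p => lam (C.Hom x x) fun i =>
          lam (id (C.Hom x y) (C.cmp x x y e i) e) fun q =>
            lam C.ob fun w => lam (C.Hom w x) fun f =>
              eq_of_isEquiv (C.Hom w x) (C.Hom w y) (C.postcomp w x y e)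
                (snd (C.preEquiv x y e) (fun _ => C.postEquiv x y e) p w) (C.cmp w x x i f) f
                (trans (C.Hom w y) (C.cmp w x y e (C.cmp w x x i f))
                  (inv (C.Hom w y) (C.cmp w x y (C.cmp x x y e i) f) (C.assoc w x x y e i f))
                  (ap (C.Hom w y) (fun k => C.cmp w x y k f) (C.cmp x x y e i) q)))
    (by decide +kernel)

/-- Every `g` is of the form `h ∘ e`, and `(h ∘ e) ∘ i = h ∘ (e ∘ i) = h ∘ e`. -/
theorem isRightNeutral_of_comp_eq :
    Holds (Cat.pi 0 0 fun C => pi C.ob fun x => pi C.ob fun y => pi (C.Hom x y) fun e =>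
      arrow (C.isEqv x y e) (pi (C.Hom x x) fun i =>
        arrow (id (C.Hom x y) (C.cmp x x y e i) e) (C.isRightNeutral x i))) :=
  holds_of_accepts
    (Cat.lam 0 0 fun C => lam C.ob fun x => lam C.ob fun y => lam (C.Hom x y) fun e =>
      lam (C.isEqv x y e) fun p => lam (C.Hom x x) fun i =>
        lam (id (C.Hom x y) (C.cmp x x y e i) e) fun q =>
          lam C.ob fun z => lam (C.Hom x z) fun g =>
            let F := fiber (C.Hom y z) (C.Hom x z) (C.precomp x y z e) g
            split (fun _ => id (C.Hom x z) (C.cmp x x z g i) g)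
              (fst F (fst (C.preEquiv x y e) p z g)) fun h r =>
                J (fun g _ => id (C.Hom x z) (C.cmp x x z g i) g) r
                  (trans (C.Hom x z) (C.cmp x x z (C.cmp x y z h e) i) (C.assoc x x y z h e i)
                    (ap (C.Hom x z) (fun k => C.cmp x y z h k) (C.cmp x x y e i) q)))
    (by decide +kernel)

theorem isNeutral_of_comp_eq :
    Holds (Cat.pi 0 0 fun C => pi C.ob fun x => pi C.ob fun y => pi (C.Hom x y) fun e =>
      arrow (C.isEqv x y e) (pi (C.Hom x x) fun i =>
        arrow (id (C.Hom x y) (C.cmp x x y e i) e) (C.isNeutral x i))) :=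
  isLeftNeutral_of_comp_eq.imp₂ isRightNeutral_of_comp_eq
    (fun left right =>
      Cat.lam 0 0 fun C => lam C.ob fun x => lam C.ob fun y => lam (C.Hom x y) fun e =>
        lam (C.isEqv x y e) fun p => lam (C.Hom x x) fun i =>
          lam (id (C.Hom x y) (C.cmp x x y e i) e) fun q =>
            pair (C.isLeftNeutral x i) (fun _ => C.isRightNeutral x i)
              (C.spec left x y e p i q) (C.spec right x y e p i q))
    (by decide +kernel)

theorem isGoodId_of_isNeutral :
    Holds (Cat.pi 0 0 fun C => pi C.ob fun x => pi (C.Hom x x) fun i =>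
      arrow (C.isNeutral x i) (C.isGoodId x i)) :=
  isEquiv_of_forall_eq.imp₁
    (fun isEquiv_of_forall_eq =>
      Cat.lam 0 0 fun C => lam C.ob fun x => lam (C.Hom x x) fun i =>
        lam (C.isNeutral x i) fun n =>
          split (fun _ => C.isGoodId x i) n fun left right =>
            pair (C.isEqv x x i) (fun _ => C.isIdem x i)
              (pair (C.preEquiv x x i) (fun _ => C.postEquiv x x i)
                (lam C.ob fun z =>
                  isEquiv_of_forall_eq (C.Hom x z) (C.precomp x x z i) (right z))
                (lam C.ob fun w =>
                  isEquiv_of_forall_eq (C.Hom w x) (C.postcomp w x x i) (left w)))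
              (left x i))
    (by decide +kernel)

/-- In the contractible fibre of `j ∘ –` over `j`, the elements `(i, r x j)` and `(j, q)` are
equal. -/
theorem exists_transport_comp_eq :
    Holds (Cat.pi 0 0 fun C => pi C.ob fun x =>
      pi (C.Hom x x) fun i => pi (C.isRightNeutral x i) fun r =>
        pi (C.Hom x x) fun j => arrow (C.isEqv x x j) (pi (C.isIdem x j) fun q =>
          sig (id (C.Hom x x) i j) fun s =>
            id (C.isIdem x j)
              (transport (fun u => id (C.Hom x x) (C.cmp x x x j u) j) s (r x j)) q)) :=
  isProp_of_isContr.imp₂ exists_transport_eq_of_pair_eq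
    (fun isProp_of_isContr exists_transport_eq_of_pair_eq =>
      Cat.lam 0 0 fun C => lam C.ob fun x =>
        lam (C.Hom x x) fun i => lam (C.isRightNeutral x i) fun r =>
          lam (C.Hom x x) fun j => lam (C.isEqv x x j) fun e => lam (C.isIdem x j) fun q =>
            let H := C.Hom x x
            let P := fun u => id H (C.cmp x x x j u) j
            let isContr_fiber := snd (C.preEquiv x x j) (fun _ => C.postEquiv x x j) e x j
            exists_transport_eq_of_pair_eq H (lam H P) i (r x j) j q
              (isProp_of_isContr (fiber H H (C.postcomp x x x j) j) isContr_fiber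
                (pair H P i (r x j)) (pair H P j q)))
    (by decide +kernel)

/-- Both transports of the right neutrality of `i` agree, by induction on `s : i = j`. -/
theorem exists_transport_isIdem_eq :
    Holds (Cat.pi 0 0 fun C => pi C.ob fun x =>
      pi (C.Hom x x) fun i => pi (C.isRightNeutral x i) fun r =>
        pi (C.Hom x x) fun j => arrow (C.isEqv x x j) (pi (C.isIdem x j) fun q =>
          sig (id (C.Hom x x) i j) fun s =>
            id (C.isIdem x j) (transport (C.isIdem x) s (r x i)) q)) :=
  exists_transport_comp_eq.imp₁
    (fun exists_transport_comp_eq =>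
      Cat.lam 0 0 fun C => lam C.ob fun x =>
        lam (C.Hom x x) fun i => lam (C.isRightNeutral x i) fun r =>
          lam (C.Hom x x) fun j => lam (C.isEqv x x j) fun e => lam (C.isIdem x j) fun q =>
            let H := C.Hom x x
            let idem := fun s => transport (C.isIdem x) s (r x i)
            let comp := fun j s => transport (fun u => id H (C.cmp x x x j u) j) s (r x j)
            let T := sig (id H i j) fun s => id (C.isIdem x j) (idem s) q
            split (fun _ => T) (C.spec exists_transport_comp_eq x i r j e q) fun s t =>
              pair (id H i j) (fun s => id (C.isIdem x j) (idem s) q) s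
                (trans (C.isIdem x j) (idem s)
                  (J (fun j s => id (C.isIdem x j) (idem s) (comp j s)) s (refl (r x i))) t))
    (by decide +kernel)

theorem goodId_eq_of_isRightNeutral :
    Holds (Cat.pi 0 0 fun C => pi C.ob fun x =>
      pi (C.Hom x x) fun i => pi (C.isEqv x x i) fun p => pi (C.isRightNeutral x i) fun r =>
        pi (C.Hom x x) fun j => pi (C.isEqv x x j) fun e => pi (C.isIdem x j) fun q =>
          id (C.GoodId x) (C.mkGoodId x i p (r x i)) (C.mkGoodId x j e q)) :=
  isProp_isEqv.imp₃ exists_transport_isIdem_eq triple_eq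
    (fun isProp_isEqv exists_transport_isIdem_eq triple_eq =>
      Cat.lam 0 0 fun C => lam C.ob fun x =>
        lam (C.Hom x x) fun i => lam (C.isEqv x x i) fun p => lam (C.isRightNeutral x i) fun r =>
          lam (C.Hom x x) fun j => lam (C.isEqv x x j) fun e => lam (C.isIdem x j) fun q =>
            let H := C.Hom x x
            split (fun _ => id (C.GoodId x) (C.mkGoodId x i p (r x i)) (C.mkGoodId x j e q))
              (C.spec exists_transport_isIdem_eq x i r j e q) fun s t =>
                triple_eq H (lam H (C.isEqv x x)) (lam H (C.isIdem x))
                  (lam H (C.spec isProp_isEqv x x)) i p (r x i) j e q s t)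
    (by decide +kernel)

/-- A good identity `(i, p, q)` is right neutral by some `r`, and the previous equality applies
both to itself and to any other one: `(i, p, q) = (i, p, r x i) = (j, e, q')`. -/
theorem isProp_goodId :
    Holds (Cat.pi 0 0 fun C => pi C.ob fun x => isProp (C.GoodId x)) :=
  isRightNeutral_of_comp_eq.imp₂ goodId_eq_of_isRightNeutral
    (fun isRightNeutral_of_comp_eq goodId_eq =>
      Cat.lam 0 0 fun C => lam C.ob fun x =>
        let G := C.GoodId x
        let mk := C.mkGoodId x
        let tail := pair (C.Hom x x) (C.isGoodId x)
        lam G fun u => lam G fun v =>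
          split (fun u => id G u v) u fun i d => split (fun d => id G (tail i d) v) d fun p q =>
            split (fun v => id G (mk i p q) v) v fun j d' =>
              split (fun d' => id G (mk i p q) (tail j d')) d' fun e q' =>
                let r := C.spec isRightNeutral_of_comp_eq x x i p i q
                trans G (mk i p q)
                  (inv G (mk i p (r x i)) (C.spec goodId_eq x i p r i p q))
                  (C.spec goodId_eq x i p r j e q'))
    (by decide +kernel)

theorem isProp_hasGoodIdStruc :
    Holds (Cat.pi 0 0 fun C => isProp C.hasGoodIdStruc) :=
  isProp_pi.imp₂ isProp_goodId
    (fun isProp_pi isProp_goodId =>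
      Cat.lam 0 0 fun C => isProp_pi C.ob (lam C.ob C.GoodId) (C.spec isProp_goodId))
    (by decide +kernel)

theorem isGoodId_iff_isNeutral :
    Holds (Cat.pi 0 0 fun C => C.goodIdIffNeutral) :=
  isNeutral_of_comp_eq.imp₂ isGoodId_of_isNeutral
    (fun isNeutral_of_comp_eq isGoodId_of_isNeutral =>
      Cat.lam 0 0 fun C => lam C.ob fun x => lam (C.Hom x x) fun i =>
        let G := C.isGoodId x i
        let N := C.isNeutral x i
        pair (arrow G N) (fun _ => arrow N G)
          (lam G fun g => split (fun _ => N) g fun p q =>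
            C.spec isNeutral_of_comp_eq x x i p i q)
          (C.spec isGoodId_of_isNeutral x i))
    (by decide +kernel)

theorem isGoodId_I :
    Holds (Cat.pi 0 0 fun C => C.goodIdOfEqv) :=
  isNeutral_of_comp_eq.imp₂ isGoodId_of_isNeutral
    (fun isNeutral_of_comp_eq isGoodId_of_isNeutral =>
      Cat.lam 0 0 fun C => lam C.ob fun x => lam C.ob fun y => lam (C.Hom x y) fun e =>
        lam (C.isEqv x y e) fun p =>
          let H := C.Hom x x
          let f := C.postcomp x x y e
          let postEquiv := snd (C.preEquiv x y e) (fun _ => C.postEquiv x y e) p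
          let center := fst (fiber H (C.Hom x y) f e) (postEquiv x e)
          let i := fst H center
          let comp_eq := snd H (fun a => id (C.Hom x y) (f a) e) center
          C.spec isGoodId_of_isNeutral x i (C.spec isNeutral_of_comp_eq x y e p i comp_eq))
    (by decide +kernel)

/-! ### Arbitrary universe levels -/

/-- The instance, at wild semicategories with `Ob : U_a` and `hom` valued in `U_b`, of a fact `l`
about those with both in `U_1`, for `a, b ≤ 1`. Cumulativity makes a type in `U_0` one in `U_1`, but
not a family valued in `U_0` one valued in `U_1`, so `hom` is replaced by
`λ x y, (λ (T : U_1), T) (hom x y)`. -/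
def lower (a b : ℕ) (l : Expr) : Expr :=
  Cat.lam a b fun C =>
    let El := lam (univ 1) fun T => T
    Cat.spec ⟨C.ob, lam C.ob fun x => lam C.ob fun y => El (C.hom x y), C.comp, C.assoc⟩ l

theorem Holds.relevel {X : Cat → Expr}
    (hX : ∀ l a b, ((Cat.pi a b X).under 0).relevel l = (Cat.pi (l a) (l b) X).under 0)
    {l : ℕ → ℕ} (hl : StrictMono l) {a b : ℕ} (h : Holds (Cat.pi a b X)) :
    Holds (Cat.pi (l a) (l b) X) :=
  (congrArg Inhabited (hX l a b)).mp (Inhabited.relevel hl h)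

theorem exists_strictMono_zero_one {i j : ℕ} (h : i < j) :
    ∃ l : ℕ → ℕ, StrictMono l ∧ l 0 = i ∧ l 1 = j :=
  ⟨fun n => i + n * (j - i),
    (strictMono_mul_right_of_pos (Nat.sub_pos_of_lt h)).const_add i,
    by simp, by simp [h.le]⟩

theorem Holds.forall_levels {X : Cat → Expr} (h : Holds (Cat.pi 0 0 X))
    (hX : ∀ l a b, ((Cat.pi a b X).under 0).relevel l = (Cat.pi (l a) (l b) X).under 0)
    (h₀₁ : accepts (lam (Cat.pi 1 1 X) (lower 0 1)) (arrow (Cat.pi 1 1 X) (Cat.pi 0 1 X)) = true)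
    (h₁₀ : accepts (lam (Cat.pi 1 1 X) (lower 1 0)) (arrow (Cat.pi 1 1 X) (Cat.pi 1 0 X)) = true)
    (i j : ℕ) : Holds (Cat.pi i j X) := by
  have h₁₁ : Holds (Cat.pi 1 1 X) := h.relevel hX (l := (· + 1)) fun _ _ => Nat.succ_lt_succ
  obtain hij | rfl | hji := lt_trichotomy i j
  · obtain ⟨l, hl, rfl, rfl⟩ := exists_strictMono_zero_one hij
    exact (h₁₁.imp₁ _ h₀₁).relevel hX hl
  · exact h.relevel hX (l := (i + ·)) (strictMono_id.const_add i)
  · obtain ⟨l, hl, rfl, rfl⟩ := exists_strictMono_zero_one hji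
    exact (h₁₁.imp₁ _ h₁₀).relevel hX hl

end Expr

end TypeTheory

theorem mainTheorem1 (i j : ℕ) :
    TypeTheory.Inhabited
        (TypeTheory.forallSemicat i j fun C => TypeTheory.isProp C.hasGoodIdStruc) ∧
      TypeTheory.Inhabited
        (TypeTheory.forallSemicat i j fun C => C.goodIdIffNeutral) ∧
      TypeTheory.Inhabited
        (TypeTheory.forallSemicat i j fun C => C.goodIdOfEqv) :=
  ⟨TypeTheory.Expr.isProp_hasGoodIdStruc.forall_levels (fun _ _ _ => rfl)
      (by decide +kernel) (by decide +kernel) i j,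
    TypeTheory.Expr.isGoodId_iff_isNeutral.forall_levels (fun _ _ _ => rfl)
      (by decide +kernel) (by decide +kernel) i j,
    TypeTheory.Expr.isGoodId_I.forall_levels (fun _ _ _ => rfl)
      (by decide +kernel) (by decide +kernel) i j⟩
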